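/- Let $\eta=\mathrm{diag}(-1,1,1,1)$. Let $SO(1,3)^\uparrow$ be the group of real $4\times4$ matrices $L$ (indices $0,\dots,3$) with $L^{\mathsf T}\eta L=\eta$, $\det L=1$, $L^0{}_0>0$, and let $\mathfrak{so}(1,3)$ be the space of real $4\times 4$ matrices $F$ with $F^{\mathsf T}\eta+\eta F=0$. Let $$ISO(1,3)^\uparrow=\Big\{\begin{pmatrix}L&-b\\0&1\end{pmatrix}: L\in SO(1,3)^\uparrow,\ b\in\mathbb R^4\Big\},\qquad \mathfrak{iso}(1,3)=\Big\{[F,w]:=\begin{pmatrix}F&-w\\0&0\end{pmatrix}: F\in\mathfrak{so}(1,3),\ w\in\mathbb R^4\Big\},$$ and consider the orbits of the adjoint action $X\mapsto gXg^{-1}$ of $ISO(1,3)^\uparrow$ on $\mathfrak{iso}(1,3)$. Let $I$ (resp. $J$) be the set of those elements of $ISO(1,3)^\uparrow$ for which $b$ is future directed timelike, i.e. $\eta(b,b)<0$ and $b^0>0$ (resp. future directed nonspacelike, i.e. $\eta(b,b)\le0$ and $b^0\ge0$; $b=0$ is allowed). For $S=I,J$ let $$L(S)=\{X\in\mathfrak{iso}(1,3):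 \exp(sX)\in S\ \text{for all } s>0\}.$$ For $\varphi,\theta\in\mathbb R$ put $$A(\varphi,\theta)=\begin{pmatrix}0&-\varphi&0&0\\-\varphi&0&0&0\\0&0&0&\theta\\0&0&-\theta&0\end{pmatrix},\qquad B=\begin{pmatrix}0&0&-1&0\\0&0&-1&0\\-1&1&0&0\\0&0&0&0\end{pmatrix}.$$ In the classification of the Ad-orbits into twelve families, the following families are the orbits of the following representatives (the parameter $\epsilon_1=\pm1$ is the time orientation): * family 1: $[A(\varphi,\theta),0]$ with $\varphi>0$, $\theta\neq0$; * family 2: $[A(\varphi,0),(0,0,0,b)]$ with $\varphi>0$, $b\ge0$; * family 4: $[A(0,\theta),(\epsilon_1 b,0,0,0)]$ with $\theta>0$, $b>0$; * family 5: $[A(0,\theta),(\epsilon_1,\epsilon_2,0,0)]$ with $\theta>0$, $\epsilon_2=\pm1$; * family 6: $[A(0,\theta),0]$ with $\theta>0$; * family 7: $[B,(\epsilon_1\sqrt{I_3},0,0,0)]$ with $I_3>0$; * family 8: $[B,(0,0,0,\sqrt{I_4})]$ with $I_4\ge0$; * family 9: $[0,(\epsilon_1\sqrt{-I_4},0,0,0)]$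 with $I_4<0$; * family 11: $[0,(\epsilon_1,\epsilon_1,0,0)]$; * family 12: the zero element. **Theorem 4.7.** The Ad-orbits on $\mathfrak{iso}(1,3)$ that have a representative in the timelike wedge $L(I)$ are exactly the orbits in families 1, 2, and in families 4, 7, 9 with $\epsilon_1=1$. The Ad-orbits that have a representative in $L(J)\setminus L(I)$ but none in $L(I)$ are exactly the orbits in families 5, 6, 11 with $\epsilon_1=1$ (where it applies, i.e. in 5 and 11; $\epsilon_2=\pm1$ is arbitrary in 5), family 8 with $I_4=0$, and the orbit of zero. -/

import Mathlib

open Matrix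

noncomputable section

namespace Poincare

/-- Coordinate vectors `(w⁰, w¹, w², w³)`. -/
abbrev Vec : Type := Fin 4 → ℝ

/-- The Minkowski metric, of signature `(-,+,+,+)`. -/
def eta : Matrix (Fin 4) (Fin 4) ℝ := Matrix.diagonal ![-1, 1, 1, 1]

/-- The scalar product `η(v, w) = η_{ab} v^a w^b`. -/
def inn (v w : Vec) : ℝ := v ⬝ᵥ (eta *ᵥ w)

/-- `w` is future directed timelike. -/
def FutureTimelike (w : Vec) : Prop := inn w w < 0 ∧ 0 < w 0

/-- `w` is future directed nonspacelike; the zero vector is included. -/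
def FutureCausal (w : Vec) : Prop := inn w w ≤ 0 ∧ 0 ≤ w 0

/-- The matrix group `SO(1,3)↑`. -/
def SO13 : Set (Matrix (Fin 4) (Fin 4) ℝ) :=
  {L | Lᵀ * eta * L = eta ∧ L.det = 1 ∧ 0 < L 0 0}

/-- The Lie algebra `so(1,3)`: `Fᵀ η = -η F`, that is, `F_{ab} + F_{ba} = 0`. -/
def so13 : Submodule ℝ (Matrix (Fin 4) (Fin 4) ℝ) :=
  skewAdjointMatricesSubmodule eta

/-- Real `5 × 5` matrices, with the index set split into `4 + 1`. -/
abbrev Mat5 : Type := Matrix (Fin 4 ⊕ Unit) (Fin 4 ⊕ Unit) ℝ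

/-- The group-type block matrix with rows `(L, -b)` and `(0, 1)`. -/
def grp (L : Matrix (Fin 4) (Fin 4) ℝ) (b : Vec) : Mat5 :=
  Matrix.fromBlocks L (-Matrix.replicateCol Unit b) 0 1

/-- The algebra-type block matrix with rows `(F, -w)` and `(0, 0)`. -/
def alg (F : Matrix (Fin 4) (Fin 4) ℝ) (w : Vec) : Mat5 :=
  Matrix.fromBlocks F (-Matrix.replicateCol Unit w) 0 0

/-- The group `ISO(1,3)↑`, as a set of matrices. -/
def ISO13 : Set Mat5 := {g | ∃ L ∈ SO13, ∃ b : Vec, g = grp L b}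

/-- The Lie algebra `iso(1,3)`, as a set of matrices. -/
def iso13 : Set Mat5 := {X | ∃ F ∈ so13, ∃ w : Vec, X = alg F w}

/-- The timelike semigroup `I` of `ISO(1,3)↑`. -/
def semiI : Set Mat5 := {g | ∃ L ∈ SO13, ∃ b : Vec, FutureTimelike b ∧ g = grp L b}

/-- The causal semigroup `J` of `ISO(1,3)↑`. -/
def semiJ : Set Mat5 := {g | ∃ L ∈ SO13, ∃ b : Vec, FutureCausal b ∧ g = grp L b}

/-- `L(S)`: the elements `X` of `iso(1,3)` with `exp (s X) ∈ S` for all `s > 0`. -/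
def wedge (S : Set Mat5) : Set Mat5 :=
  {X | X ∈ iso13 ∧ ∀ s : ℝ, 0 < s → NormedSpace.exp (s • X) ∈ S}

/-- The orbit of `X` under the Ad-action `X ↦ g X g⁻¹` of `ISO(1,3)↑`. -/
def adOrbit (X : Mat5) : Set Mat5 := {Y | ∃ g ∈ ISO13, Y = g * X * g⁻¹}

/-- The set of all Ad-orbits on `iso(1,3)`. -/
def adOrbits : Set (Set Mat5) := {O | ∃ X ∈ iso13, O = adOrbit X}

/-- Canonical form of a nonnull homogeneous part. -/
def formA (φ θ : ℝ) : Matrix (Fin 4) (Fin 4) ℝ :=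
  !![0, -φ, 0, 0;
    -φ, 0, 0, 0;
    0, 0, 0, θ;
    0, 0, -θ, 0]

/-- Canonical form of a nonzero null homogeneous part. -/
def formB : Matrix (Fin 4) (Fin 4) ℝ :=
  !![0, 0, -1, 0;
    0, 0, -1, 0;
    -1, 1, 0, 0;
    0, 0, 0, 0]

/-! The families of Ad-orbits of `iso(1,3)`;
an orbit belongs to a family if it is the orbit of one of the canonical representatives of the family.
The time orientation `ε₁` (for `family8`, the invariant `I₄`) is an argument, the other
parameters run over their whole range. -/

/-- `F` nonsingular, `w = 0`. -/
def family1 : Set (Set Mat5) :=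
  {O | ∃ φ θ : ℝ, 0 < φ ∧ θ ≠ 0 ∧ O = adOrbit (alg (formA φ θ) ![0, 0, 0, 0])}

/-- `F` an infinitesimal boost, `w` orthogonal to the plane of the boost. -/
def family2 : Set (Set Mat5) :=
  {O | ∃ φ b : ℝ, 0 < φ ∧ 0 ≤ b ∧ O = adOrbit (alg (formA φ 0) ![0, 0, 0, b])}

/-- `F` an infinitesimal rotation, `w` timelike and fixed by the rotation. -/
def family4 (ε₁ : ℝ) : Set (Set Mat5) :=
  {O | ∃ θ b : ℝ, 0 < θ ∧ 0 < b ∧ O = adOrbit (alg (formA 0 θ) ![ε₁ * b, 0, 0, 0])}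

/-- `F` an infinitesimal rotation, `w ≠ 0` null and fixed by the rotation; the helicity `ε₂` is
arbitrary. -/
def family5 (ε₁ : ℝ) : Set (Set Mat5) :=
  {O | ∃ θ ε₂ : ℝ, 0 < θ ∧ (ε₂ = 1 ∨ ε₂ = -1) ∧
    O = adOrbit (alg (formA 0 θ) ![ε₁, ε₂, 0, 0])}

/-- `F` an infinitesimal rotation, `w = 0`. -/
def family6 : Set (Set Mat5) :=
  {O | ∃ θ : ℝ, 0 < θ ∧ O = adOrbit (alg (formA 0 θ) ![0, 0, 0, 0])}

/-- `F` an infinitesimal null rotation, `w` timelike. -/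
def family7 (ε₁ : ℝ) : Set (Set Mat5) :=
  {O | ∃ I₃ : ℝ, 0 < I₃ ∧ O = adOrbit (alg formB ![ε₁ * √I₃, 0, 0, 0])}

/-- `F` an infinitesimal null rotation, `w` in its kernel, for a given value `I₄ ≥ 0` of `η(w, w)`. -/
def family8 (I₄ : ℝ) : Set (Set Mat5) :=
  {O | 0 ≤ I₄ ∧ O = adOrbit (alg formB ![0, 0, 0, √I₄])}

/-- Timelike translations; `I₄ = η(w, w) < 0`. -/
def family9 (ε₁ : ℝ) : Set (Set Mat5) :=
  {O | ∃ I₄ : ℝ, I₄ < 0 ∧ O = adOrbit (alg 0 ![ε₁ * √(-I₄), 0, 0, 0])}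

/-- Nonzero null translations. -/
def family11 (ε₁ : ℝ) : Set (Set Mat5) := {adOrbit (alg 0 ![ε₁, ε₁, 0, 0])}

/-- The trivial orbit of the origin. -/
def family12 : Set (Set Mat5) := {adOrbit 0}

end Poincare

end

noncomputable section

namespace Poincare

/-! ### The Lorentz group -/

/-! For $X=[F,w]$ one has $\exp(sX)=(\exp(sF),-c(s))$, where $c'=Fc+w$ and $c(0)=0$. Since
$\exp(sF)$ always lies in $SO(1,3)^\uparrow$, membership in $L(I)$ or $L(J)$ is a condition on the
displacement curve $c$ alone (`alg_mem_wedge_iff`). Lorentz transformations preserve the future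
cones and hence both wedges, while translations replace $w$ by $w+Fc$. So an orbit meets a wedge iff
some $[F,w+Fc]$ lies in it (`adOrbit_alg_meets_iff`), and $F$ may be taken in canonical form
(`exists_canonical_normalized`).

If $F=A(\varphi,\theta)$ with $\varphi>0$, a translation adds an arbitrarily large timelike
component in the boost plane, and every orbit meets $L(I)$ (`boosted_timelike`). If $F=A(0,\theta)$
with $\theta>0$, the rotating components of $c$ vanish after a full period, so the part of $w$ in
the fixed plane must be causal; boosts of that plane normalize it. If $F=B$, the curve is cubic with
$c^0-c^1=(w^0-w^1)s$ and $\eta(c,c)=s^2\eta(w,w)-(w^0-w^1)^2s^4/12$; causality forces $w^0>w^1$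
(family 7), or $w^0=w^1$ and $w^3=0$ (family 8 with $I_4=0$). If $F=0$, then $c(s)=sw$.

Hence every orbit meeting $L(J)$ is in one of the two lists (`mem_families_of_meets_causal`). The
first list meets $L(I)$ (`mem_timelikeFamilies`), the second meets $L(J)$ but not $L(I)$
(`mem_causalFamilies`), and both equalities follow. -/

lemma eta_mul_eta : eta * eta = 1 := by
  ext i j
  fin_cases i <;> fin_cases j <;> simp [eta]

lemma inn_apply (v w : Vec) :
    inn v w = -(v 0 * w 0) + v 1 * w 1 + v 2 * w 2 + v 3 * w 3 := by
  simp [inn, eta, dotProduct, Fin.sum_univ_four, mulVec_diagonal]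

lemma inn_mulVec {L : Matrix (Fin 4) (Fin 4) ℝ} (hL : Lᵀ * eta * L = eta) (v w : Vec) :
    inn (L *ᵥ v) (L *ᵥ w) = inn v w := by
  unfold inn
  conv_rhs => rw [← hL]
  rw [← vecMul_transpose, ← dotProduct_mulVec, mulVec_mulVec, mulVec_mulVec, Matrix.mul_assoc]

lemma mul_eta_mul_transpose {L : Matrix (Fin 4) (Fin 4) ℝ} (hL : Lᵀ * eta * L = eta) :
    L * eta * Lᵀ = eta := by
  have h1 : (eta * Lᵀ * eta) * L = 1 := by
    rw [Matrix.mul_assoc eta, Matrix.mul_assoc eta, hL, eta_mul_eta]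
  have h2 : L * (eta * Lᵀ * eta) = 1 := mul_eq_one_comm.mp h1
  calc L * eta * Lᵀ = L * (eta * Lᵀ * eta) * eta := by
        simp only [Matrix.mul_assoc, eta_mul_eta, Matrix.mul_one]
    _ = eta := by rw [h2, Matrix.one_mul]

lemma row_zero_norm {L : Matrix (Fin 4) (Fin 4) ℝ} (hL : Lᵀ * eta * L = eta) :
    L 0 0 ^ 2 = 1 + L 0 1 ^ 2 + L 0 2 ^ 2 + L 0 3 ^ 2 := by
  have h := congrFun (congrFun (mul_eta_mul_transpose hL) 0) 0
  simp [eta, Matrix.mul_apply, Fin.sum_univ_four, Matrix.diagonal_apply] at h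
  linarith

lemma spatial_cauchy (a₁ a₂ a₃ b₁ b₂ b₃ : ℝ) :
    (a₁ * b₁ + a₂ * b₂ + a₃ * b₃) ^ 2
      ≤ (a₁ ^ 2 + a₂ ^ 2 + a₃ ^ 2) * (b₁ ^ 2 + b₂ ^ 2 + b₃ ^ 2) := by
  nlinarith [sq_nonneg (a₁ * b₂ - a₂ * b₁), sq_nonneg (a₁ * b₃ - a₃ * b₁),
    sq_nonneg (a₂ * b₃ - a₃ * b₂)]

/-- By $L\eta L^{\mathsf T}=\eta$ the top row of $L$ is timelike, so Cauchy–Schwarz bounds the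
spatial part of its product with $b$ by $L^0{}_0b^0$. -/
lemma mulVec_zero_nonneg {L : Matrix (Fin 4) (Fin 4) ℝ} (hL : L ∈ SO13) {b : Vec}
    (hb : FutureCausal b) : 0 ≤ (L *ᵥ b) 0 := by
  have h0 := row_zero_norm hL.1
  obtain ⟨h1, h2⟩ := hb
  rw [inn_apply] at h1
  have hcs := spatial_cauchy (L 0 1) (L 0 2) (L 0 3) (b 1) (b 2) (b 3)
  have hle : (L 0 1 * b 1 + L 0 2 * b 2 + L 0 3 * b 3) ^ 2 ≤ (L 0 0 * b 0) ^ 2 := by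
    refine hcs.trans ?_
    rw [mul_pow]
    apply mul_le_mul <;> nlinarith [sq_nonneg (L 0 0)]
  have := abs_le.mp (abs_le_of_sq_le_sq hle (mul_nonneg hL.2.2.le h2))
  simp only [mulVec, dotProduct, Fin.sum_univ_four]
  linarith [this.1]

lemma FutureTimelike.causal {b : Vec} (hb : FutureTimelike b) : FutureCausal b :=
  ⟨hb.1.le, hb.2.le⟩

lemma FutureCausal.mulVec {L : Matrix (Fin 4) (Fin 4) ℝ} (hL : L ∈ SO13) {b : Vec}
    (hb : FutureCausal b) : FutureCausal (L *ᵥ b) :=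
  ⟨by rw [inn_mulVec hL.1]; exact hb.1, mulVec_zero_nonneg hL hb⟩

lemma FutureTimelike.mulVec {L : Matrix (Fin 4) (Fin 4) ℝ} (hL : L ∈ SO13) {b : Vec}
    (hb : FutureTimelike b) : FutureTimelike (L *ᵥ b) := by
  have h : inn (L *ᵥ b) (L *ᵥ b) < 0 := by rw [inn_mulVec hL.1]; exact hb.1
  refine ⟨h, lt_of_le_of_ne (mulVec_zero_nonneg hL hb.causal) fun h0 => ?_⟩
  rw [inn_apply, ← h0] at h
  nlinarith [sq_nonneg ((L *ᵥ b) 1), sq_nonneg ((L *ᵥ b) 2), sq_nonneg ((L *ᵥ b) 3)]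

lemma futureTimelike_single : FutureTimelike (Pi.single 0 1) := by
  simp [FutureTimelike, inn_apply]

lemma SO13_mul {L M : Matrix (Fin 4) (Fin 4) ℝ} (hL : L ∈ SO13) (hM : M ∈ SO13) :
    L * M ∈ SO13 := by
  refine ⟨?_, by rw [det_mul, hL.2.1, hM.2.1, one_mul], ?_⟩
  · calc (L * M)ᵀ * eta * (L * M) = Mᵀ * (Lᵀ * eta * L) * M := by
          simp only [transpose_mul, Matrix.mul_assoc]
      _ = eta := by rw [hL.1, hM.1]
  -- The entry `(L * M) 0 0` is the time component of $LMe_0$, and $e_0$ is future timelike.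
  · have h := ((futureTimelike_single.mulVec hM).mulVec hL).2
    rw [mulVec_mulVec] at h
    simpa using h

lemma SO13_isUnit_det {L : Matrix (Fin 4) (Fin 4) ℝ} (hL : L ∈ SO13) : IsUnit L.det := by
  rw [hL.2.1]; exact isUnit_one

lemma SO13_inv_eq {L : Matrix (Fin 4) (Fin 4) ℝ} (hL : L ∈ SO13) :
    L⁻¹ = eta * Lᵀ * eta := by
  apply inv_eq_left_inv
  rw [Matrix.mul_assoc eta, Matrix.mul_assoc eta, hL.1, eta_mul_eta]

lemma SO13_inv {L : Matrix (Fin 4) (Fin 4) ℝ} (hL : L ∈ SO13) : L⁻¹ ∈ SO13 := by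
  have hu := SO13_isUnit_det hL
  refine ⟨?_, by rw [det_nonsing_inv, hL.2.1]; simp, ?_⟩
  · calc L⁻¹ᵀ * eta * L⁻¹ = L⁻¹ᵀ * (Lᵀ * eta * L) * L⁻¹ := by rw [hL.1]
      _ = (L * L⁻¹)ᵀ * eta * (L * L⁻¹) := by simp only [transpose_mul, Matrix.mul_assoc]
      _ = eta := by rw [mul_nonsing_inv _ hu]; simp
  · rw [SO13_inv_eq hL]
    simpa [eta, Matrix.mul_apply, Fin.sum_univ_four, Matrix.diagonal_apply] using hL.2.2

lemma SO13_one : (1 : Matrix (Fin 4) (Fin 4) ℝ) ∈ SO13 := by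
  simp [SO13]

lemma mem_so13 {F : Matrix (Fin 4) (Fin 4) ℝ} : F ∈ so13 ↔ Fᵀ * eta = eta * -F :=
  mem_skewAdjointMatricesSubmodule eta F

lemma so13_conj {L F F' : Matrix (Fin 4) (Fin 4) ℝ} (hL : L ∈ SO13) (hF : F ∈ so13)
    (h : L * F = F' * L) : F' ∈ so13 := by
  rw [mem_so13] at *
  have hu := SO13_isUnit_det hL
  have hF' : F' = L * F * L⁻¹ := by rw [h, mul_nonsing_inv_cancel_right _ _ hu]
  have hη : eta * L = L⁻¹ᵀ * eta := by
    rw [SO13_inv_eq hL]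
    have : etaᵀ = eta := by simp [eta]
    simp [transpose_mul, this, Matrix.mul_assoc, eta_mul_eta]
  have hη' : Lᵀ * eta = eta * L⁻¹ := by
    rw [SO13_inv_eq hL]
    simp only [← Matrix.mul_assoc, eta_mul_eta, Matrix.one_mul]
  calc F'ᵀ * eta = L⁻¹ᵀ * (Fᵀ * (Lᵀ * eta)) := by
        rw [hF']; simp only [transpose_mul, Matrix.mul_assoc]
    _ = L⁻¹ᵀ * (Fᵀ * eta) * L⁻¹ := by rw [hη']; simp only [Matrix.mul_assoc]
    _ = (L⁻¹ᵀ * eta) * -F * L⁻¹ := by rw [hF]; simp only [Matrix.mul_assoc]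
    _ = eta * -F' := by rw [← hη, hF']; simp [Matrix.mul_assoc]

lemma exp_isometry {F : Matrix (Fin 4) (Fin 4) ℝ} (hF : F ∈ so13) :
    (NormedSpace.exp F)ᵀ * eta * NormedSpace.exp F = eta := by
  rw [mem_so13] at hF
  have hη : eta⁻¹ = eta := inv_eq_left_inv eta_mul_eta
  have hu : IsUnit eta := ⟨⟨eta, eta, eta_mul_eta, eta_mul_eta⟩, rfl⟩
  have h1 : Fᵀ = eta * (-F) * eta⁻¹ := by
    rw [hη, ← hF, Matrix.mul_assoc, eta_mul_eta, Matrix.mul_one]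
  rw [← Matrix.exp_transpose, h1, Matrix.exp_conj _ _ hu, hη, Matrix.exp_neg]
  rw [Matrix.mul_assoc _ eta eta, eta_mul_eta, Matrix.mul_one, Matrix.mul_assoc,
    nonsing_inv_mul _ ((Matrix.isUnit_iff_isUnit_det _).mp (Matrix.isUnit_exp F)), Matrix.mul_one]

lemma exp_eq_half_mul_half (F : Matrix (Fin 4) (Fin 4) ℝ) :
    NormedSpace.exp F =
      NormedSpace.exp ((2⁻¹ : ℝ) • F) * NormedSpace.exp ((2⁻¹ : ℝ) • F) := by
  rw [← Matrix.exp_add_of_commute _ _ (Commute.refl _), ← add_smul]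
  norm_num

/-- An isometry of $\eta$ has determinant of square one, and $\exp F$ is the square of the isometry
$\exp(F/2)$. -/
lemma det_exp_so13 {F : Matrix (Fin 4) (Fin 4) ℝ} (hF : F ∈ so13) :
    (NormedSpace.exp F).det = 1 := by
  have h := congrArg det (exp_isometry (so13.smul_mem (2⁻¹ : ℝ) hF))
  have he : eta.det ≠ 0 := by simp [eta, det_diagonal, Fin.prod_univ_four]
  rw [det_mul, det_mul, det_transpose] at h
  rw [exp_eq_half_mul_half, det_mul]
  apply mul_right_cancel₀ he
  linarith

lemma exp_mem_SO13 {F : Matrix (Fin 4) (Fin 4) ℝ} (hF : F ∈ so13) :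
    NormedSpace.exp F ∈ SO13 := by
  refine ⟨exp_isometry hF, det_exp_so13 hF, ?_⟩
  have hG : (2⁻¹ : ℝ) • F ∈ so13 := so13.smul_mem _ hF
  rw [exp_eq_half_mul_half]
  have hiso := exp_isometry hG
  have hdet := det_exp_so13 hG
  set M := NormedSpace.exp ((2⁻¹ : ℝ) • F)
  have h0 := row_zero_norm hiso
  -- The square of $M=\exp(F/2)$ is insensitive to the sign of $M$. In even dimension $-M$ has the
  -- same determinant, so either $M$ or $-M$ is orthochronous; $M^0{}_0=0$ contradicts the norm of
  -- the top row.
  rcases lt_trichotomy (M 0 0) 0 with h | h | h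
  · have hN : -M ∈ SO13 := by
      refine ⟨by simpa using hiso, by rw [det_neg, hdet]; norm_num [Fintype.card_fin], ?_⟩
      simpa using h
    simpa using (SO13_mul hN hN).2.2
  · rw [h] at h0
    nlinarith [sq_nonneg (M 0 1), sq_nonneg (M 0 2), sq_nonneg (M 0 3)]
  · exact (SO13_mul ⟨hiso, hdet, h⟩ ⟨hiso, hdet, h⟩).2.2

/-! ### The Poincaré group and its adjoint action -/

lemma grp_mul_grp (L M : Matrix (Fin 4) (Fin 4) ℝ) (b c : Vec) :
    grp L b * grp M c = grp (L * M) (L *ᵥ c + b) := by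
  simp only [grp, fromBlocks_multiply]
  congr 1
  · simp
  · ext i j
    simp [Matrix.mul_apply, Matrix.mulVec, dotProduct]; ring
  · simp
  · simp

lemma grp_mul_alg (L F : Matrix (Fin 4) (Fin 4) ℝ) (b w : Vec) :
    grp L b * alg F w = alg (L * F) (L *ᵥ w) := by
  simp only [grp, alg, fromBlocks_multiply]
  congr 1
  · simp
  · ext i j
    simp [Matrix.mul_apply, Matrix.mulVec, dotProduct]
  · simp
  · simp

lemma alg_mul_grp (L F : Matrix (Fin 4) (Fin 4) ℝ) (b w : Vec) :
    alg F w * grp L b = alg (F * L) (F *ᵥ b + w) := by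
  simp only [grp, alg, fromBlocks_multiply]
  congr 1
  · simp
  · ext i j
    simp [Matrix.mul_apply, Matrix.mulVec, dotProduct]; ring
  · simp
  · simp

lemma grp_one_zero : grp 1 0 = 1 := by
  have : (replicateCol Unit (0 : Vec) : Matrix (Fin 4) Unit ℝ) = 0 := by ext; simp
  simp [grp, this]

lemma grp_inj {L M : Matrix (Fin 4) (Fin 4) ℝ} {b c : Vec} (h : grp L b = grp M c) :
    L = M ∧ b = c := by
  obtain ⟨h1, h2, -, -⟩ := fromBlocks_inj.mp h
  exact ⟨h1, funext fun i => by simpa using congrFun (congrFun h2 i) ()⟩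

lemma alg_inj {L M : Matrix (Fin 4) (Fin 4) ℝ} {b c : Vec} (h : alg L b = alg M c) :
    L = M ∧ b = c := by
  obtain ⟨h1, h2, -, -⟩ := fromBlocks_inj.mp h
  exact ⟨h1, funext fun i => by simpa using congrFun (congrFun h2 i) ()⟩

lemma grp_mul_grp_inv {L : Matrix (Fin 4) (Fin 4) ℝ} (hL : L ∈ SO13) (b : Vec) :
    grp L b * grp L⁻¹ (-(L⁻¹ *ᵥ b)) = 1 := by
  rw [grp_mul_grp, mul_nonsing_inv _ (SO13_isUnit_det hL), mulVec_neg, mulVec_mulVec,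
    mul_nonsing_inv _ (SO13_isUnit_det hL), one_mulVec, neg_add_cancel, grp_one_zero]

lemma ISO13_isUnit_det {g : Mat5} (hg : g ∈ ISO13) : IsUnit g.det := by
  obtain ⟨L, hL, b, rfl⟩ := hg
  exact isUnit_det_of_right_inverse (grp_mul_grp_inv hL b)

lemma ISO13_inv {g : Mat5} (hg : g ∈ ISO13) : g⁻¹ ∈ ISO13 := by
  obtain ⟨L, hL, b, rfl⟩ := hg
  exact ⟨_, SO13_inv hL, _, inv_eq_right_inv (grp_mul_grp_inv hL b)⟩

lemma ISO13_mul {g h : Mat5} (hg : g ∈ ISO13) (hh : h ∈ ISO13) : g * h ∈ ISO13 := by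
  obtain ⟨L, hL, b, rfl⟩ := hg
  obtain ⟨M, hM, c, rfl⟩ := hh
  exact ⟨_, SO13_mul hL hM, _, grp_mul_grp L M b c⟩

lemma mem_adOrbit {X Y : Mat5} : Y ∈ adOrbit X ↔ ∃ g ∈ ISO13, g * X = Y * g := by
  constructor
  · rintro ⟨g, hg, rfl⟩
    exact ⟨g, hg, by rw [nonsing_inv_mul_cancel_right _ _ (ISO13_isUnit_det hg)]⟩
  · rintro ⟨g, hg, h⟩
    exact ⟨g, hg, by rw [h, mul_nonsing_inv_cancel_right _ _ (ISO13_isUnit_det hg)]⟩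

lemma mem_adOrbit_self (X : Mat5) : X ∈ adOrbit X :=
  mem_adOrbit.mpr ⟨1, ⟨1, SO13_one, 0, grp_one_zero.symm⟩, by simp⟩

lemma adOrbit_subset {X Y : Mat5} (h : Y ∈ adOrbit X) : adOrbit Y ⊆ adOrbit X := by
  rintro Z hZ
  rw [mem_adOrbit] at *
  obtain ⟨g, hg, h⟩ := h
  obtain ⟨k, hk, h'⟩ := hZ
  exact ⟨k * g, ISO13_mul hk hg, by
    rw [Matrix.mul_assoc, h, ← Matrix.mul_assoc, h', Matrix.mul_assoc]⟩

lemma adOrbit_symm {X Y : Mat5} (h : Y ∈ adOrbit X) : X ∈ adOrbit Y := by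
  obtain ⟨g, hg, rfl⟩ := h
  have hu := ISO13_isUnit_det hg
  refine mem_adOrbit.mpr ⟨g⁻¹, ISO13_inv hg, ?_⟩
  rw [Matrix.mul_assoc g, nonsing_inv_mul_cancel_left _ _ hu]

lemma adOrbit_eq_of_mem {X Y : Mat5} (h : Y ∈ adOrbit X) : adOrbit X = adOrbit Y :=
  (adOrbit_subset (adOrbit_symm h)).antisymm (adOrbit_subset h)

/-- Conjugation by a Lorentz transformation, followed by a translation. -/
lemma adOrbit_alg_eq {L F F' : Matrix (Fin 4) (Fin 4) ℝ} (hL : L ∈ SO13) (h : L * F = F' * L)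
    (w c : Vec) : adOrbit (alg F w) = adOrbit (alg F' (L *ᵥ w + F' *ᵥ c)) := by
  apply adOrbit_eq_of_mem
  refine mem_adOrbit.mpr ⟨grp L (-c), ⟨L, hL, _, rfl⟩, ?_⟩
  rw [grp_mul_alg, alg_mul_grp, h, mulVec_neg]
  congr 1
  abel

lemma adOrbit_alg_translate (F : Matrix (Fin 4) (Fin 4) ℝ) (w c : Vec) :
    adOrbit (alg F w) = adOrbit (alg F (w + F *ᵥ c)) := by
  simpa using adOrbit_alg_eq SO13_one (F := F) (F' := F) (by simp) w c

lemma mem_adOrbit_alg {F : Matrix (Fin 4) (Fin 4) ℝ} {w : Vec} {Y : Mat5}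
    (hY : Y ∈ adOrbit (alg F w)) :
    ∃ L ∈ SO13, ∃ c : Vec, Y = alg (L * F * L⁻¹) (L *ᵥ (w + F *ᵥ c)) := by
  obtain ⟨g, ⟨L, hL, b, rfl⟩, rfl⟩ := hY
  refine ⟨L, hL, -(L⁻¹ *ᵥ b), ?_⟩
  rw [inv_eq_right_inv (grp_mul_grp_inv hL b), grp_mul_alg, alg_mul_grp, mulVec_add,
    mulVec_mulVec, add_comm]

/-! ### One-parameter subgroups -/

/-- The elements of `ISO(1,3)↑` whose displacement satisfies `P`. -/
def semi (P : Vec → Prop) : Set Mat5 := {g | ∃ L ∈ SO13, ∃ b : Vec, P b ∧ g = grp L b}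

lemma alg_smul (s : ℝ) (F : Matrix (Fin 4) (Fin 4) ℝ) (w : Vec) :
    s • alg F w = alg (s • F) (s • w) := by
  simp only [alg, fromBlocks_smul]
  congr 1
  · ext i j; simp
  · simp
  · simp

/-- `alg` as a linear map. -/
def algLin : Matrix (Fin 4) (Fin 4) ℝ × Vec →ₗ[ℝ] Mat5 where
  toFun p := alg p.1 p.2
  map_add' p q := by
    simp only [alg, fromBlocks_add, Prod.fst_add, Prod.snd_add]
    congr 1
    · ext i j; simp; ring
    · simp
    · simp
  map_smul' s p := by simp [alg_smul]

lemma grp_eq_algLin (L : Matrix (Fin 4) (Fin 4) ℝ) (b : Vec) :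
    grp L b = fromBlocks 0 0 0 1 + algLin (L, b) := by
  simp [grp, algLin, alg, fromBlocks_add]

section
open scoped Matrix.Norms.Operator

/-- Both sides solve $G'=XG$, $G(0)=1$; uniqueness comes from $e^{-uX}G(u)$ having zero derivative.
Exhibiting $c$ as a solution avoids summing the exponential series. -/
lemma exp_smul_alg (F : Matrix (Fin 4) (Fin 4) ℝ) (w : Vec) (c : ℝ → Vec) (h0 : c 0 = 0)
    (hc : ∀ s, HasDerivAt c (F *ᵥ c s + w) s) (s : ℝ) :
    NormedSpace.exp (s • alg F w) = grp (NormedSpace.exp (s • F)) (c s) := by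
  set X := alg F w with hX
  let G : ℝ → Mat5 := fun t => grp (NormedSpace.exp (t • F)) (c t)
  have hG : ∀ t, HasDerivAt G (X * G t) t := by
    intro t
    have h1 : HasDerivAt (fun u : ℝ => NormedSpace.exp (u • F))
        (F * NormedSpace.exp (t • F)) t := hasDerivAt_exp_smul_const' F t
    have h2 := (LinearMap.toContinuousLinearMap algLin).hasFDerivAt.comp_hasDerivAt t
      (h1.prodMk (hc t))
    have h3 := h2.const_add (fromBlocks 0 0 0 1 : Mat5)
    have e1 : G = fun u => (fromBlocks 0 0 0 1 : Mat5) +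
        (LinearMap.toContinuousLinearMap algLin ∘
          fun u => (NormedSpace.exp (u • F), c u)) u := by
      funext u
      simp [G, grp_eq_algLin]
    have e2 : X * G t = LinearMap.toContinuousLinearMap algLin
        (F * NormedSpace.exp (t • F), F *ᵥ c t + w) := by
      simp [G, hX, alg_mul_grp, algLin]
    rw [e2, e1]
    exact h3
  have hE : ∀ t, HasDerivAt (fun u : ℝ => NormedSpace.exp (u • (-X)))
      (NormedSpace.exp (t • (-X)) * (-X)) t := fun t => hasDerivAt_exp_smul_const (-X) t
  have hD : ∀ t, HasDerivAt (fun u => NormedSpace.exp (u • (-X)) * G u) 0 t := by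
    intro t
    refine ((hE t).mul (hG t)).congr_deriv ?_
    simp [Matrix.mul_assoc]
  have hconst := is_const_of_deriv_eq_zero (fun t => (hD t).differentiableAt)
    (fun t => (hD t).deriv) s 0
  have hG0 : G 0 = 1 := by simp [G, h0, grp_one_zero]
  simp only [zero_smul, NormedSpace.exp_zero, hG0, Matrix.mul_one] at hconst
  rw [smul_neg, Matrix.exp_neg] at hconst
  have hu := (Matrix.isUnit_iff_isUnit_det _).mp (Matrix.isUnit_exp (s • X))
  have := congrArg (fun Z => NormedSpace.exp (s • X) * Z) hconst
  simp only [mul_nonsing_inv_cancel_left _ _ hu, Matrix.mul_one] at this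
  exact this.symm

end

lemma alg_mem_wedge_iff {P : Vec → Prop} {F : Matrix (Fin 4) (Fin 4) ℝ} (hF : F ∈ so13)
    {w : Vec} {c : ℝ → Vec} (h0 : c 0 = 0) (hc : ∀ s, HasDerivAt c (F *ᵥ c s + w) s) :
    alg F w ∈ wedge (semi P) ↔ ∀ s, 0 < s → P (c s) := by
  constructor
  · rintro ⟨-, h⟩ s hs
    obtain ⟨L, -, b, hb, he⟩ := h s hs
    rw [exp_smul_alg F w c h0 hc] at he
    rwa [(grp_inj he).2]
  · intro h
    refine ⟨⟨F, hF, w, rfl⟩, fun s hs => ?_⟩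
    rw [exp_smul_alg F w c h0 hc]
    exact ⟨_, exp_mem_SO13 (so13.smul_mem s hF), _, h s hs, rfl⟩

/-- Conjugation by a Lorentz transformation carries the displacement $b$ to $Lb$. Translations are
excluded: they add $(1-e^{sF})$ applied to a fixed vector, which need not respect the cone. -/
lemma wedge_conj {P : Vec → Prop} (hP : ∀ L ∈ SO13, ∀ b, P b → P (L *ᵥ b))
    {L F F' : Matrix (Fin 4) (Fin 4) ℝ} (hL : L ∈ SO13) (h : L * F = F' * L) {w : Vec}
    (hw : alg F w ∈ wedge (semi P)) : alg F' (L *ᵥ w) ∈ wedge (semi P) := by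
  obtain ⟨⟨F₀, hF, w₀, he⟩, hexp⟩ := hw
  obtain ⟨rfl, rfl⟩ := alg_inj he
  refine ⟨⟨F', so13_conj hL hF h, _, rfl⟩, fun s hs => ?_⟩
  obtain ⟨M, hM, b, hb, hE⟩ := hexp s hs
  have hu : IsUnit (grp L 0) :=
    (Matrix.isUnit_iff_isUnit_det _).mpr (ISO13_isUnit_det ⟨L, hL, 0, rfl⟩)
  have hconj : s • alg F' (L *ᵥ w) = grp L 0 * (s • alg F w) * (grp L 0)⁻¹ := by
    have : grp L 0 * alg F w = alg F' (L *ᵥ w) * grp L 0 := by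
      rw [grp_mul_alg, alg_mul_grp, h]; simp
    rw [Matrix.mul_smul, this, Matrix.smul_mul,
      mul_nonsing_inv_cancel_right _ _ (ISO13_isUnit_det ⟨L, hL, 0, rfl⟩)]
  rw [hconj, Matrix.exp_conj _ _ hu, hE, inv_eq_right_inv (grp_mul_grp_inv hL 0), grp_mul_grp,
    grp_mul_grp]
  exact ⟨_, SO13_mul (SO13_mul hL hM) (SO13_inv hL), _, hP L hL b hb, by simp⟩

/-- An orbit meets an invariant wedge iff a translate of its representative lies in the wedge. -/
lemma adOrbit_alg_meets_iff {P : Vec → Prop} (hP : ∀ L ∈ SO13, ∀ b, P b → P (L *ᵥ b))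
    (F : Matrix (Fin 4) (Fin 4) ℝ) (w : Vec) :
    (adOrbit (alg F w) ∩ wedge (semi P)).Nonempty ↔
      ∃ c, alg F (w + F *ᵥ c) ∈ wedge (semi P) := by
  constructor
  · rintro ⟨Y, hY, hw⟩
    obtain ⟨L, hL, c, rfl⟩ := mem_adOrbit_alg hY
    have hu := SO13_isUnit_det hL
    -- Undoing the Lorentz part of the conjugation leaves only the translation.
    have := wedge_conj hP (SO13_inv hL) (F' := F)
      (by rw [Matrix.mul_assoc, nonsing_inv_mul_cancel_left _ _ hu]) hw
    rw [mulVec_mulVec, nonsing_inv_mul _ hu, one_mulVec] at this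
    exact ⟨c, this⟩
  · rintro ⟨c, hc⟩
    exact ⟨_, by rw [adOrbit_alg_translate F w c]; exact mem_adOrbit_self _, hc⟩

/-! ### Elementary Lorentz transformations -/

/-- The matrix in `so(1,3)` with electric part `(e₁, e₂, e₃)` and magnetic part `(b₁, b₂, b₃)`. -/
def field (e₁ e₂ e₃ b₁ b₂ b₃ : ℝ) : Matrix (Fin 4) (Fin 4) ℝ :=
  !![0, e₁, e₂, e₃;
    e₁, 0, b₃, -b₂;
    e₂, -b₃, 0, b₁;
    e₃, b₂, -b₁, 0]

/-- Rotation in the `12`-plane. -/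
def rot12 (c s : ℝ) : Matrix (Fin 4) (Fin 4) ℝ :=
  !![1, 0, 0, 0;
    0, c, -s, 0;
    0, s, c, 0;
    0, 0, 0, 1]

/-- Rotation in the `23`-plane. -/
def rot23 (c s : ℝ) : Matrix (Fin 4) (Fin 4) ℝ :=
  !![1, 0, 0, 0;
    0, 1, 0, 0;
    0, 0, c, -s;
    0, 0, s, c]

/-- The rotation permuting the spatial axes cyclically. -/
def cyc : Matrix (Fin 4) (Fin 4) ℝ :=
  !![1, 0, 0, 0;
    0, 0, 0, 1;
    0, 1, 0, 0;
    0, 0, 1, 0]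

/-- Boost in the `01`-plane. -/
def boost01 (c s : ℝ) : Matrix (Fin 4) (Fin 4) ℝ :=
  !![c, s, 0, 0;
    s, c, 0, 0;
    0, 0, 1, 0;
    0, 0, 0, 1]

/-- Boost in the `03`-plane. -/
def boost03 (c s : ℝ) : Matrix (Fin 4) (Fin 4) ℝ :=
  !![c, 0, 0, s;
    0, 1, 0, 0;
    0, 0, 1, 0;
    s, 0, 0, c]

/-- Null rotation about `e₀ + e₁` in the direction of `e₃`. -/
def nullRot (t : ℝ) : Matrix (Fin 4) (Fin 4) ℝ :=
  !![1 + t ^ 2 / 2, -(t ^ 2 / 2), 0, -t;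
    t ^ 2 / 2, 1 - t ^ 2 / 2, 0, -t;
    0, 0, 1, 0;
    -t, t, 0, 1]

lemma rot12_mem {c s : ℝ} (h : c ^ 2 + s ^ 2 = 1) : rot12 c s ∈ SO13 := by
  refine ⟨?_, ?_, by simp [rot12]⟩
  · ext i j
    fin_cases i <;> fin_cases j <;>
      simp [rot12, eta, Matrix.mul_apply, Fin.sum_univ_four, Matrix.diagonal_apply] <;> grind
  · simp [rot12, det_succ_row_zero, Fin.sum_univ_succ, Fin.succAbove]
    linear_combination h

lemma rot23_mem {c s : ℝ} (h : c ^ 2 + s ^ 2 = 1) : rot23 c s ∈ SO13 := by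
  refine ⟨?_, ?_, by simp [rot23]⟩
  · ext i j
    fin_cases i <;> fin_cases j <;>
      simp [rot23, eta, Matrix.mul_apply, Fin.sum_univ_four, Matrix.diagonal_apply] <;> grind
  · simp [rot23, det_succ_row_zero, Fin.sum_univ_succ, Fin.succAbove]
    linear_combination h

lemma cyc_mem : cyc ∈ SO13 := by
  refine ⟨?_, ?_, by simp [cyc]⟩
  · ext i j
    fin_cases i <;> fin_cases j <;>
      simp [cyc, eta, Matrix.mul_apply, Fin.sum_univ_four, Matrix.diagonal_apply]
  · simp [cyc, det_succ_row_zero, Fin.sum_univ_succ, Fin.succAbove]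

lemma boost01_mem {c s : ℝ} (h : c ^ 2 - s ^ 2 = 1) (hc : 0 < c) : boost01 c s ∈ SO13 := by
  refine ⟨?_, ?_, by simpa [boost01]⟩
  · ext i j
    fin_cases i <;> fin_cases j <;>
      simp [boost01, eta, Matrix.mul_apply, Fin.sum_univ_four, Matrix.diagonal_apply] <;> grind
  · simp [boost01, det_succ_row_zero, Fin.sum_univ_succ, Fin.succAbove]
    linear_combination h

lemma boost03_mem {c s : ℝ} (h : c ^ 2 - s ^ 2 = 1) (hc : 0 < c) : boost03 c s ∈ SO13 := by
  refine ⟨?_, ?_, by simpa [boost03]⟩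
  · ext i j
    fin_cases i <;> fin_cases j <;>
      simp [boost03, eta, Matrix.mul_apply, Fin.sum_univ_four, Matrix.diagonal_apply] <;> grind
  · simp [boost03, det_succ_row_zero, Fin.sum_univ_succ, Fin.succAbove]
    linear_combination h

lemma nullRot_mem (t : ℝ) : nullRot t ∈ SO13 := by
  refine ⟨?_, ?_, ?_⟩
  · ext i j
    fin_cases i <;> fin_cases j <;>
      simp [nullRot, eta, Matrix.mul_apply, Fin.sum_univ_four, Matrix.diagonal_apply] <;> ring
  · simp [nullRot, det_succ_row_zero, Fin.sum_univ_succ, Fin.succAbove]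
    ring
  · simp [nullRot]; positivity

/-! ### Canonical forms of the homogeneous part -/

/-- Conjugacy under the restricted Lorentz group. -/
def LorentzConj (F F' : Matrix (Fin 4) (Fin 4) ℝ) : Prop := ∃ L ∈ SO13, L * F = F' * L

lemma LorentzConj.refl (F : Matrix (Fin 4) (Fin 4) ℝ) : LorentzConj F F :=
  ⟨1, SO13_one, by simp⟩

lemma LorentzConj.trans {F G H : Matrix (Fin 4) (Fin 4) ℝ} (h₁ : LorentzConj F G)
    (h₂ : LorentzConj G H) : LorentzConj F H := by
  obtain ⟨L, hL, h⟩ := h₁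
  obtain ⟨M, hM, h'⟩ := h₂
  exact ⟨M * L, SO13_mul hM hL, by
    rw [Matrix.mul_assoc, h, ← Matrix.mul_assoc, h', Matrix.mul_assoc]⟩

lemma field_rot12 {c s : ℝ} (h : c ^ 2 + s ^ 2 = 1) (e₁ e₂ e₃ b₁ b₂ b₃ : ℝ) :
    LorentzConj (field e₁ e₂ e₃ b₁ b₂ b₃)
      (field (c * e₁ - s * e₂) (s * e₁ + c * e₂) e₃ (c * b₁ - s * b₂) (s * b₁ + c * b₂) b₃) := by
  refine ⟨rot12 c s, rot12_mem h, ?_⟩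
  ext i j
  fin_cases i <;> fin_cases j <;>
    simp [rot12, field, Matrix.mul_apply, Fin.sum_univ_four] <;> grind

lemma field_rot23 {c s : ℝ} (h : c ^ 2 + s ^ 2 = 1) (e₁ e₂ e₃ b₁ b₂ b₃ : ℝ) :
    LorentzConj (field e₁ e₂ e₃ b₁ b₂ b₃)
      (field e₁ (c * e₂ - s * e₃) (s * e₂ + c * e₃) b₁ (c * b₂ - s * b₃) (s * b₂ + c * b₃)) := by
  refine ⟨rot23 c s, rot23_mem h, ?_⟩
  ext i j
  fin_cases i <;> fin_cases j <;>
    simp [rot23, field, Matrix.mul_apply, Fin.sum_univ_four] <;> grind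

lemma field_cyc (e₁ e₂ e₃ b₁ b₂ b₃ : ℝ) :
    LorentzConj (field e₁ e₂ e₃ b₁ b₂ b₃) (field e₃ e₁ e₂ b₃ b₁ b₂) := by
  refine ⟨cyc, cyc_mem, ?_⟩
  ext i j
  fin_cases i <;> fin_cases j <;> simp [cyc, field, Matrix.mul_apply, Fin.sum_univ_four]

lemma field_boost03 {c s : ℝ} (h : c ^ 2 - s ^ 2 = 1) (hc : 0 < c) (e₁ e₂ e₃ b₁ b₂ b₃ : ℝ) :
    LorentzConj (field e₁ e₂ e₃ b₁ b₂ b₃)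
      (field (c * e₁ + s * b₂) (c * e₂ - s * b₁) e₃ (c * b₁ - s * e₂) (c * b₂ + s * e₁) b₃) := by
  refine ⟨boost03 c s, boost03_mem h hc, ?_⟩
  ext i j
  fin_cases i <;> fin_cases j <;>
    simp [boost03, field, Matrix.mul_apply, Fin.sum_univ_four] <;> grind

lemma formA_eq_field (φ θ : ℝ) : formA φ θ = field (-φ) 0 0 θ 0 0 := by
  simp [formA, field]

lemma formB_eq_field : formB = field 0 (-1) 0 0 0 (-1) := by
  simp [formB, field]

lemma exists_field_of_mem {F : Matrix (Fin 4) (Fin 4) ℝ} (hF : F ∈ so13) :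
    ∃ e₁ e₂ e₃ b₁ b₂ b₃, F = field e₁ e₂ e₃ b₁ b₂ b₃ := by
  rw [mem_so13] at hF
  have h : ∀ i j, (Fᵀ * eta) i j = (eta * -F) i j := fun i j => by rw [hF]
  simp [eta, Matrix.mul_diagonal, Matrix.diagonal_mul] at h
  refine ⟨F 0 1, F 0 2, F 0 3, F 2 3, F 3 1, F 1 2, ?_⟩
  have h' := fun i j => h i j
  simp [Fin.forall_fin_succ] at h'
  ext i j
  fin_cases i <;> fin_cases j <;> simp [field] <;> grind

lemma field_mem_so13 (e₁ e₂ e₃ b₁ b₂ b₃ : ℝ) : field e₁ e₂ e₃ b₁ b₂ b₃ ∈ so13 := by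
  rw [mem_so13]
  ext i j
  fin_cases i <;> fin_cases j <;>
    simp [field, eta, Matrix.mul_apply, Matrix.diagonal_apply]

lemma formA_mem_so13 (φ θ : ℝ) : formA φ θ ∈ so13 := by
  rw [formA_eq_field]; exact field_mem_so13 _ _ _ _ _ _

lemma formB_mem_so13 : formB ∈ so13 := by
  rw [formB_eq_field]; exact field_mem_so13 _ _ _ _ _ _

/-- A plane rotation onto the first axis. -/
lemma exists_rotation (x y : ℝ) :
    ∃ c s : ℝ, c ^ 2 + s ^ 2 = 1 ∧ s * x + c * y = 0 ∧ 0 ≤ c * x - s * y := by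
  by_cases h : x ^ 2 + y ^ 2 = 0
  · exact ⟨1, 0, by norm_num, by nlinarith, by nlinarith⟩
  · have hp : 0 < x ^ 2 + y ^ 2 := lt_of_le_of_ne (by positivity) (Ne.symm h)
    have hr := Real.sqrt_pos.mpr hp
    have hr2 := Real.sq_sqrt hp.le
    set r := √(x ^ 2 + y ^ 2)
    refine ⟨x / r, -y / r, ?_, ?_, ?_⟩
    · field_simp; linarith
    · field_simp; ring
    · have : x / r * x - -y / r * y = r := by field_simp; linarith
      rw [this]; exact hr.le

/-- Hyperbolic functions of rapidity `log k`. -/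
lemma exists_boost {k : ℝ} (hk : 0 < k) :
    ∃ c s : ℝ, c ^ 2 - s ^ 2 = 1 ∧ 0 < c ∧ c + s = k ∧ c - s = k⁻¹ := by
  refine ⟨(k + k⁻¹) / 2, (k - k⁻¹) / 2, ?_, by positivity, by ring, by ring⟩
  have := mul_inv_cancel₀ hk.ne'
  linear_combination this

/-- One rotation brings the electric vector onto the first axis; the residual freedom about that
axis removes the third magnetic component. -/
lemma field_conj_planar (e₁ e₂ e₃ b₁ b₂ b₃ : ℝ) :
    ∃ e p q, LorentzConj (field e₁ e₂ e₃ b₁ b₂ b₃) (field e 0 0 p q 0) := by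
  obtain ⟨c, s, h, hz, -⟩ := exists_rotation e₂ e₃
  have h1 := field_rot23 h e₁ e₂ e₃ b₁ b₂ b₃
  rw [hz] at h1
  obtain ⟨c', s', h', hz', -⟩ := exists_rotation e₁ (c * e₂ - s * e₃)
  have h2 := h1.trans (field_rot12 h' _ _ _ _ _ _)
  rw [hz'] at h2
  generalize c' * b₁ - s' * (c * b₂ - s * b₃) = β₁ at h2
  generalize s' * b₁ + c' * (c * b₂ - s * b₃) = β₂ at h2
  generalize s * b₂ + c * b₃ = β₃ at h2
  obtain ⟨c'', s'', h'', hz'', -⟩ := exists_rotation β₂ β₃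
  have h3 := h2.trans (field_rot23 h'' _ _ _ _ _ _)
  rw [hz''] at h3
  simp only [mul_zero, sub_zero, add_zero] at h3
  exact ⟨_, _, _, h3⟩

/-- The hypothesis says that the two vectors in the 12-plane are parallel, so a single rotation
sends both to the first axis. -/
lemma field_conj_of_parallel {x y u v : ℝ} (h : x * v = y * u) :
    ∃ φ θ, LorentzConj (field x y 0 u v 0) (formA φ θ) := by
  obtain ⟨c, s, hcs, hz, hz'⟩ : ∃ c s : ℝ, c ^ 2 + s ^ 2 = 1 ∧ s * x + c * y = 0 ∧
      s * u + c * v = 0 := by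
    by_cases hxy : x = 0 ∧ y = 0
    · obtain ⟨rfl, rfl⟩ := hxy
      obtain ⟨c, s, hcs, hz, -⟩ := exists_rotation u v
      exact ⟨c, s, hcs, by ring, hz⟩
    · obtain ⟨c, s, hcs, hz, -⟩ := exists_rotation x y
      refine ⟨c, s, hcs, hz, ?_⟩
      have h1 : x * (s * u + c * v) = 0 := by linear_combination u * hz + c * h
      have h2 : y * (s * u + c * v) = 0 := by linear_combination v * hz - s * h
      by_contra hne
      exact hxy ⟨(mul_eq_zero.mp h1).resolve_right hne, (mul_eq_zero.mp h2).resolve_right hne⟩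
  have h1 := field_rot12 hcs x y 0 u v 0
  rw [hz, hz'] at h1
  refine ⟨-(c * x - s * y), c * u - s * v, ?_⟩
  rwa [formA_eq_field, neg_neg]

/-- A boost along the third axis, the direction of $E\times B$, rescales a null field by $c+s$, here
chosen as $1/|e|$. A half turn then fixes the sign, and a cyclic permutation of the axes gives $B$.
-/
lemma field_conj_of_null {e : ℝ} (he : e ≠ 0) :
    LorentzConj (field e 0 0 0 e 0) formB := by
  obtain ⟨c, s, h, hc, hk, -⟩ := exists_boost (inv_pos.mpr (abs_pos.mpr he))
  have h1 := field_boost03 h hc e 0 0 0 e 0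
  have e1 : c * e + s * e = |e|⁻¹ * e := by rw [← hk]; ring
  rw [e1] at h1
  simp only [mul_zero, sub_zero] at h1
  have h2 : LorentzConj (field (|e|⁻¹ * e) 0 0 0 (|e|⁻¹ * e) 0) (field (-1) 0 0 0 (-1) 0) := by
    rcases lt_or_gt_of_ne he with hn | hp
    · have : |e|⁻¹ * e = -1 := by rw [abs_of_neg hn]; field_simp
      rw [this]; exact LorentzConj.refl _
    · have : |e|⁻¹ * e = 1 := by rw [abs_of_pos hp]; field_simp
      rw [this]
      simpa using field_rot12 (c := -1) (s := 0) (by norm_num) 1 0 0 0 1 0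
  rw [formB_eq_field]
  exact (h1.trans h2).trans (field_cyc _ _ _ _ _ _)

/-- A restricted Lorentz transformation brings every element of `so(1,3)` to canonical form. -/
lemma exists_canonical {F : Matrix (Fin 4) (Fin 4) ℝ} (hF : F ∈ so13) :
    (∃ φ θ, LorentzConj F (formA φ θ)) ∨ LorentzConj F formB := by
  obtain ⟨e₁, e₂, e₃, b₁, b₂, b₃, rfl⟩ := exists_field_of_mem hF
  obtain ⟨e, p, q, h⟩ := field_conj_planar e₁ e₂ e₃ b₁ b₂ b₃
  -- $E\times B=(0,0,eq)$. If it is nonzero, a boost along it makes $E$ and $B$ parallel, except in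
  -- the null case $E\perp B$, $|E|=|B|$, that is $p=0$, $q=\pm e$.
  by_cases hpar : e * q = 0
  · obtain ⟨φ, θ, h'⟩ := field_conj_of_parallel (x := e) (y := 0) (u := p) (v := q)
      (by rw [hpar]; ring)
    exact Or.inl ⟨φ, θ, h.trans h'⟩
  have he : e ≠ 0 := left_ne_zero_of_mul hpar
  by_cases h1 : p = 0 ∧ e = q
  · obtain ⟨rfl, rfl⟩ := h1
    exact Or.inr (h.trans (field_conj_of_null he))
  by_cases h2 : p = 0 ∧ q = -e
  · obtain ⟨rfl, rfl⟩ := h2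
    have h3 := field_rot23 (c := -1) (s := 0) (by norm_num) e 0 0 0 (-e) 0
    simp only [mul_zero, zero_mul, sub_zero, add_zero, neg_mul_neg, one_mul] at h3
    exact Or.inr ((h.trans h3).trans (field_conj_of_null he))
  left
  have hpos : ∀ x : ℝ, ¬ (p = 0 ∧ x = 0) → 0 < p ^ 2 + x ^ 2 := by
    intro x hx
    refine lt_of_le_of_ne (by positivity) fun h0 => hx ⟨?_, ?_⟩ <;> nlinarith
  have hm : 0 < p ^ 2 + (e - q) ^ 2 := hpos _ fun hx => h1 ⟨hx.1, by linarith [hx.2]⟩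
  have hp : 0 < p ^ 2 + (e + q) ^ 2 := hpos _ fun hx => h2 ⟨hx.1, by linarith [hx.2]⟩
  have hr := div_pos hm hp
  have hk := Real.sqrt_pos.mpr (Real.sqrt_pos.mpr hr)
  -- With $c+s=k$ and $c-s=k^{-1}$, the boosted vectors are parallel iff
  -- $k^2(p^2+(e+q)^2)=k^{-2}(p^2+(e-q)^2)$, which determines $k^4$.
  have hk4 : √√((p ^ 2 + (e - q) ^ 2) / (p ^ 2 + (e + q) ^ 2)) ^ 4
      = (p ^ 2 + (e - q) ^ 2) / (p ^ 2 + (e + q) ^ 2) := by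
    rw [show (4 : ℕ) = 2 * 2 from rfl, pow_mul, Real.sq_sqrt (Real.sqrt_nonneg _),
      Real.sq_sqrt hr.le]
  rw [eq_div_iff hp.ne'] at hk4
  obtain ⟨c, s, hcs, hc, hks, hks'⟩ := exists_boost hk
  set k := √√((p ^ 2 + (e - q) ^ 2) / (p ^ 2 + (e + q) ^ 2))
  have hb := field_boost03 hcs hc e 0 0 p q 0
  obtain ⟨φ, θ, h'⟩ := field_conj_of_parallel (x := c * e + s * q) (y := c * 0 - s * p)
    (u := c * p - s * 0) (v := c * q + s * e) (by
      have hkk : k ^ 2 * (c - s) ^ 2 = 1 := by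
        rw [hks', ← mul_pow, mul_inv_cancel₀ hk.ne', one_pow]
      have h5 : (c + s) ^ 2 * (p ^ 2 + (e + q) ^ 2) = (c - s) ^ 2 * (p ^ 2 + (e - q) ^ 2) := by
        rw [hks]
        linear_combination (c - s) ^ 2 * hk4 - k ^ 2 * (p ^ 2 + (e + q) ^ 2) * hkk
      linear_combination h5 / 4)
  exact ⟨φ, θ, (h.trans hb).trans h'⟩

/-- A half turn in the 12-plane reverses both parameters together, so making $\varphi$ positive
leaves the sign of $\theta$ free. -/
lemma formA_conj_neg (φ θ : ℝ) : LorentzConj (formA φ θ) (formA (-φ) (-θ)) := by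
  have := field_rot12 (c := -1) (s := 0) (by norm_num) (-φ) 0 0 θ 0 0
  rw [formA_eq_field, formA_eq_field]
  simpa using this

/-- Canonical forms with normalized signs of the parameters. -/
lemma exists_canonical_normalized {F : Matrix (Fin 4) (Fin 4) ℝ} (hF : F ∈ so13) :
    (∃ φ θ, 0 < φ ∧ LorentzConj F (formA φ θ)) ∨ (∃ θ, 0 ≤ θ ∧ LorentzConj F (formA 0 θ)) ∨
      LorentzConj F formB := by
  rcases exists_canonical hF with ⟨φ, θ, h⟩ | h
  · have h' := h.trans (formA_conj_neg φ θ)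
    rcases lt_trichotomy φ 0 with hφ | rfl | hφ
    · exact Or.inl ⟨_, _, neg_pos.mpr hφ, h'⟩
    · rw [neg_zero] at h'
      rcases le_total 0 θ with hθ | hθ
      · exact Or.inr (Or.inl ⟨_, hθ, h⟩)
      · exact Or.inr (Or.inl ⟨_, neg_nonneg.mpr hθ, h'⟩)
    · exact Or.inl ⟨_, _, hφ, h⟩
  · exact Or.inr (Or.inr h)

/-! ### Displacement along one-parameter subgroups -/

lemma exists_vec_eq (w : Vec) : ∃ a b d e : ℝ, w = ![a, b, d, e] :=
  ⟨w 0, w 1, w 2, w 3, by ext i; fin_cases i <;> rfl⟩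

lemma formA_mulVec (φ θ a b d e : ℝ) :
    formA φ θ *ᵥ ![a, b, d, e] = ![-φ * b, -φ * a, θ * e, -θ * d] := by
  ext i
  fin_cases i <;> simp [formA, mulVec, dotProduct, Fin.sum_univ_four]

lemma formB_mulVec (a b d e : ℝ) : formB *ᵥ ![a, b, d, e] = ![-d, -d, b - a, 0] := by
  ext i
  fin_cases i <;> simp [formB, mulVec, dotProduct, Fin.sum_univ_four]
  ring

lemma formA_zero_zero : formA 0 0 = 0 := by
  ext i j
  fin_cases i <;> fin_cases j <;> simp [formA]

lemma hasDerivAt_vec {f₀ f₁ f₂ f₃ : ℝ → ℝ} {d : Vec} {s : ℝ} (h₀ : HasDerivAt f₀ (d 0) s)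
    (h₁ : HasDerivAt f₁ (d 1) s) (h₂ : HasDerivAt f₂ (d 2) s) (h₃ : HasDerivAt f₃ (d 3) s) :
    HasDerivAt (fun t => (![f₀ t, f₁ t, f₂ t, f₃ t] : Vec)) d s := by
  rw [hasDerivAt_pi]
  intro i
  fin_cases i <;> assumption

lemma alg_mem_wedge_iff_of_mulVec_eq_zero {P : Vec → Prop} {F : Matrix (Fin 4) (Fin 4) ℝ}
    (hF : F ∈ so13) {w : Vec} (hw : F *ᵥ w = 0) :
    alg F w ∈ wedge (semi P) ↔ ∀ s : ℝ, 0 < s → P (s • w) := by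
  refine alg_mem_wedge_iff hF (by simp) fun s => ?_
  rw [mulVec_smul, hw, smul_zero, zero_add]
  simpa using (hasDerivAt_id s).smul_const w

/-- The displacement grows linearly in the fixed 01-plane and runs around a circle through the
origin in the 23-plane. -/
lemma alg_formA_rotation_mem_wedge_iff {P : Vec → Prop} {θ : ℝ} (hθ : θ ≠ 0) (a b d e : ℝ) :
    alg (formA 0 θ) ![a, b, d, e] ∈ wedge (semi P) ↔ ∀ s, 0 < s →
      P ![a * s, b * s, (d * Real.sin (θ * s) + e * (1 - Real.cos (θ * s))) / θ,
        (e * Real.sin (θ * s) + d * (Real.cos (θ * s) - 1)) / θ] := by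
  refine alg_mem_wedge_iff (formA_mem_so13 0 θ) (by ext i; fin_cases i <;> simp) fun s => ?_
  have hl : HasDerivAt (fun t : ℝ => θ * t) θ s := by
    simpa using (hasDerivAt_id s).const_mul θ
  have hs := hl.sin
  have hc := hl.cos
  rw [formA_mulVec]
  apply hasDerivAt_vec
  · simpa using (hasDerivAt_id s).const_mul a
  · simpa using (hasDerivAt_id s).const_mul b
  · refine (((hs.const_mul d).add ((hc.const_sub 1).const_mul e)).div_const θ).congr_deriv ?_
    simp
    field_simp
    ring
  · refine (((hs.const_mul e).add ((hc.sub_const 1).const_mul d)).div_const θ).congr_deriv ?_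
    simp
    field_simp
    ring

/-- Since $B^3=0$, the displacement is the cubic $sw+\tfrac{s^2}{2}Bw+\tfrac{s^3}{6}B^2w$. -/
lemma alg_formB_mem_wedge_iff {P : Vec → Prop} (a b d e : ℝ) :
    alg formB ![a, b, d, e] ∈ wedge (semi P) ↔ ∀ s, 0 < s →
      P ![a * s - d * s ^ 2 / 2 + (a - b) * s ^ 3 / 6, b * s - d * s ^ 2 / 2 + (a - b) * s ^ 3 / 6,
        d * s - (a - b) * s ^ 2 / 2, e * s] := by
  refine alg_mem_wedge_iff formB_mem_so13 (by ext i; fin_cases i <;> simp) fun s => ?_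
  have h1 : ∀ k : ℝ, HasDerivAt (fun t : ℝ => k * t) k s := fun k => by
    simpa using (hasDerivAt_id s).const_mul k
  have h2 : ∀ k : ℝ, HasDerivAt (fun t : ℝ => k * t ^ 2 / 2) (k * s) s := fun k =>
    (((hasDerivAt_pow 2 s).const_mul k).div_const 2).congr_deriv (by simp; ring)
  have h3 : ∀ k : ℝ, HasDerivAt (fun t : ℝ => k * t ^ 3 / 6) (k * s ^ 2 / 2) s := fun k =>
    (((hasDerivAt_pow 3 s).const_mul k).div_const 6).congr_deriv (by simp; ring)
  rw [formB_mulVec]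
  apply hasDerivAt_vec
  · refine (((h1 a).sub (h2 d)).add (h3 (a - b))).congr_deriv ?_
    simp; ring
  · refine (((h1 b).sub (h2 d)).add (h3 (a - b))).congr_deriv ?_
    simp; ring
  · refine ((h1 d).sub (h2 (a - b))).congr_deriv ?_
    simp; ring
  · refine (h1 e).congr_deriv ?_
    simp

lemma inn_vec (a b d e : ℝ) :
    inn ![a, b, d, e] ![a, b, d, e] = -a ^ 2 + b ^ 2 + d ^ 2 + e ^ 2 := by
  rw [inn_apply]; simp; ring

lemma futureTimelike_vec {a b d e : ℝ} :
    FutureTimelike ![a, b, d, e] ↔ b ^ 2 + d ^ 2 + e ^ 2 < a ^ 2 ∧ 0 < a := by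
  simp only [FutureTimelike, inn_vec]
  constructor <;> rintro ⟨h, h'⟩ <;> exact ⟨by linarith, by simpa using h'⟩

lemma futureCausal_vec {a b d e : ℝ} :
    FutureCausal ![a, b, d, e] ↔ b ^ 2 + d ^ 2 + e ^ 2 ≤ a ^ 2 ∧ 0 ≤ a := by
  simp only [FutureCausal, inn_vec]
  constructor <;> rintro ⟨h, h'⟩ <;> exact ⟨by linarith, by simpa using h'⟩

lemma FutureTimelike.smul {w : Vec} (h : FutureTimelike w) {s : ℝ} (hs : 0 < s) :
    FutureTimelike (s • w) := by
  obtain ⟨a, b, d, e, rfl⟩ := exists_vec_eq w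
  have h' := futureTimelike_vec.mp h
  have : s • ![a, b, d, e] = ![s * a, s * b, s * d, s * e] := by simp
  rw [this, futureTimelike_vec]
  exact ⟨by nlinarith [mul_pos hs hs], mul_pos hs h'.2⟩

lemma FutureCausal.smul {w : Vec} (h : FutureCausal w) {s : ℝ} (hs : 0 < s) :
    FutureCausal (s • w) := by
  obtain ⟨a, b, d, e, rfl⟩ := exists_vec_eq w
  have h' := futureCausal_vec.mp h
  have : s • ![a, b, d, e] = ![s * a, s * b, s * d, s * e] := by simp
  rw [this, futureCausal_vec]
  exact ⟨by nlinarith [mul_pos hs hs], mul_nonneg hs.le h'.2⟩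

lemma wedge_semiI_subset : wedge semiI ⊆ wedge semiJ := by
  rintro X ⟨hX, h⟩
  refine ⟨hX, fun s hs => ?_⟩
  obtain ⟨L, hL, b, hb, he⟩ := h s hs
  exact ⟨L, hL, b, hb.causal, he⟩

/-- In the boost plane the displacement is a chord of a hyperbola, with $\eta$-square
$-r^2(2\cosh\varphi s-2)/\varphi^2\le-r^2s^2$; this beats the linear drift $bs$ as $b<r$. The
condition $\theta b=0$ covers families 1 and 2 at once. -/
lemma boosted_timelike {φ : ℝ} (hφ : 0 < φ) (θ : ℝ) {r b : ℝ} (hb : 0 ≤ b) (hr : b < r)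
    (h : θ * b = 0) : alg (formA φ θ) ![r, 0, 0, b] ∈ wedge semiI := by
  refine (alg_mem_wedge_iff (P := FutureTimelike) (formA_mem_so13 φ θ)
    (c := fun s => ![r * (Real.sinh (φ * s) / φ), r * ((1 - Real.cosh (φ * s)) / φ), 0, b * s])
    (by ext i; fin_cases i <;> simp) fun s => ?_).mpr fun s hs => ?_
  · have hl : HasDerivAt (fun t : ℝ => φ * t) φ s := by
      simpa using (hasDerivAt_id s).const_mul φ
    rw [formA_mulVec]
    apply hasDerivAt_vec
    · refine ((hl.sinh.div_const φ).const_mul r).congr_deriv ?_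
      simp
      field_simp
      ring
    · refine (((hl.cosh.const_sub 1).div_const φ).const_mul r).congr_deriv ?_
      simp
      field_simp
    · refine (hasDerivAt_const s (0 : ℝ)).congr_deriv ?_
      rcases mul_eq_zero.mp h with rfl | rfl <;> simp
    · simpa using (hasDerivAt_id s).const_mul b
  · have hx : 0 < φ * s := mul_pos hφ hs
    have hr0 : 0 < r := hb.trans_lt hr
    -- From $2\cosh x-2=4\sinh^2(x/2)$ and $\sinh y\ge y$ for $y\ge0$.
    have hcosh : (φ * s) ^ 2 ≤ 2 * Real.cosh (φ * s) - 2 := by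
      have h1 := Real.cosh_two_mul (φ * s / 2)
      have h2 := Real.cosh_sq (φ * s / 2)
      have h3 := Real.self_le_sinh_iff.mpr (by positivity : 0 ≤ φ * s / 2)
      rw [mul_div_cancel₀ _ two_ne_zero] at h1
      nlinarith
    have hsq := Real.cosh_sq (φ * s)
    rw [futureTimelike_vec]
    refine ⟨?_, mul_pos hr0 (div_pos (Real.sinh_pos_iff.mpr hx) hφ)⟩
    have h1 : (r * (Real.sinh (φ * s) / φ)) ^ 2 - (r * ((1 - Real.cosh (φ * s)) / φ)) ^ 2
        = r ^ 2 * ((2 * Real.cosh (φ * s) - 2) / φ ^ 2) := by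
      field_simp
      linear_combination -hsq
    have h2 : s ^ 2 ≤ (2 * Real.cosh (φ * s) - 2) / φ ^ 2 := by
      rw [le_div_iff₀ (by positivity)]; linarith
    have h3 : (b * s) ^ 2 < r ^ 2 * s ^ 2 := by
      rw [mul_pow]; gcongr
    nlinarith [sq_nonneg r]

/-! ### Canonical forms of the translational part -/

lemma adOrbit_formA_eq_of_ne {φ θ : ℝ} (hφ : φ ≠ 0) (hθ : θ ≠ 0) (w : Vec) :
    adOrbit (alg (formA φ θ) w) = adOrbit (alg (formA φ θ) ![0, 0, 0, 0]) := by
  obtain ⟨a, b, d, e, rfl⟩ := exists_vec_eq w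
  rw [adOrbit_alg_translate _ _ ![b / φ, a / φ, e / θ, -(d / θ)], formA_mulVec]
  congr 2
  ext i
  fin_cases i <;> simp <;> field_simp <;> simp

lemma adOrbit_formA_boost_eq {φ : ℝ} (hφ : φ ≠ 0) (w : Vec) :
    ∃ r, 0 ≤ r ∧ adOrbit (alg (formA φ 0) w) = adOrbit (alg (formA φ 0) ![0, 0, 0, r]) := by
  obtain ⟨a, b, d, e, rfl⟩ := exists_vec_eq w
  -- The arguments $(e,-d)$ make the rotated vector land on the third axis rather than the second.
  obtain ⟨c, s, h, hz, hr⟩ := exists_rotation e (-d)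
  refine ⟨_, hr, ?_⟩
  rw [adOrbit_alg_eq (rot23_mem h) (F' := formA φ 0) _ _ ![b / φ, a / φ, 0, 0], formA_mulVec]
  · congr 2
    ext i
    fin_cases i <;> simp [rot23]
    · field_simp; simp
    · field_simp; simp
    · linear_combination -hz
    · ring
  · ext i j
    fin_cases i <;> fin_cases j <;> simp [rot23, formA, Matrix.mul_apply, Fin.sum_univ_four]

lemma adOrbit_formA_rotation_drop {θ : ℝ} (hθ : θ ≠ 0) (a b d e : ℝ) :
    adOrbit (alg (formA 0 θ) ![a, b, d, e]) = adOrbit (alg (formA 0 θ) ![a, b, 0, 0]) := by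
  rw [adOrbit_alg_translate _ _ ![0, 0, e / θ, -(d / θ)], formA_mulVec]
  congr 2
  ext i
  fin_cases i <;> simp <;> field_simp <;> simp

lemma adOrbit_formA_rotation_boost {c s : ℝ} (h : c ^ 2 - s ^ 2 = 1) (hc : 0 < c) (θ a b : ℝ) :
    adOrbit (alg (formA 0 θ) ![a, b, 0, 0]) =
      adOrbit (alg (formA 0 θ) ![c * a + s * b, s * a + c * b, 0, 0]) := by
  rw [adOrbit_alg_eq (boost01_mem h hc) (F' := formA 0 θ) _ _ 0]
  · congr 2
    ext i
    fin_cases i <;> simp [boost01] <;> ring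
  · ext i j
    fin_cases i <;> fin_cases j <;> simp [boost01, formA, Matrix.mul_apply, Fin.sum_univ_four]

/-- Reduction of a future causal vector in the plane fixed by a rotation. -/
lemma adOrbit_formA_rotation_causal (θ : ℝ) {a b : ℝ} (hab : b ^ 2 ≤ a ^ 2) (ha : 0 ≤ a) :
    (∃ r, 0 < r ∧ adOrbit (alg (formA 0 θ) ![a, b, 0, 0])
        = adOrbit (alg (formA 0 θ) ![r, 0, 0, 0])) ∨
      (0 < a ∧ b = a ∧ adOrbit (alg (formA 0 θ) ![a, b, 0, 0])
        = adOrbit (alg (formA 0 θ) ![1, 1, 0, 0])) ∨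
      (0 < a ∧ b = -a ∧ adOrbit (alg (formA 0 θ) ![a, b, 0, 0])
        = adOrbit (alg (formA 0 θ) ![1, -1, 0, 0])) ∨
      a = 0 ∧ b = 0 := by
  rcases ha.eq_or_lt with rfl | ha
  · exact Or.inr (Or.inr (Or.inr ⟨rfl, by nlinarith⟩))
  obtain ⟨hl, hu⟩ := abs_le.mp (abs_le_of_sq_le_sq hab ha.le)
  rcases hu.eq_or_lt with rfl | hu
  · obtain ⟨c, s, h, hc, hk, -⟩ := exists_boost (inv_pos.mpr ha)
    refine Or.inr (Or.inl ⟨ha, rfl, ?_⟩)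
    have h1 : c * b + s * b = 1 := by rw [← add_mul, hk, inv_mul_cancel₀ ha.ne']
    rw [adOrbit_formA_rotation_boost h hc, h1, add_comm, h1]
  rcases hl.eq_or_lt with hl | hl
  · obtain ⟨c, s, h, hc, -, hk⟩ := exists_boost ha
    refine Or.inr (Or.inr (Or.inl ⟨ha, hl.symm, ?_⟩))
    have h1 : (c - s) * a = 1 := by rw [hk, inv_mul_cancel₀ ha.ne']
    rw [adOrbit_formA_rotation_boost h hc, ← hl]
    congr 3
    · linear_combination h1
    · congr 1
      linear_combination -h1
  · have hp : 0 < a + b := by linarith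
    have hm : 0 < a - b := by linarith
    -- The spatial component vanishes when $k(a+b)=k^{-1}(a-b)$.
    have hkp := Real.sqrt_pos.mpr (div_pos hm hp)
    have hk2 := Real.sq_sqrt (div_pos hm hp).le
    set k := √((a - b) / (a + b))
    obtain ⟨c, s, h, hc, hk, hk'⟩ := exists_boost hkp
    refine Or.inl ⟨c * a + s * b, ?_, ?_⟩
    · have : 2 * (c * a + s * b) = k * (a + b) + k⁻¹ * (a - b) := by
        rw [← hk', ← hk]; ring
      have : 0 < k * (a + b) + k⁻¹ * (a - b) := by positivity
      linarith
    · rw [adOrbit_formA_rotation_boost h hc]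
      have h1 : 2 * (s * a + c * b) = k * (a + b) - k⁻¹ * (a - b) := by
        rw [← hk', ← hk]; ring
      have h2 : k * (a + b) = k⁻¹ * (a - b) := by
        rw [eq_div_iff hp.ne'] at hk2
        field_simp
        exact hk2
      have h3 : s * a + c * b = 0 := by linarith
      rw [h3]

/-- A spatial rotation takes any vector to the `01`-plane. -/
lemma adOrbit_translation_planar {w : Vec} (hw : FutureCausal w) :
    ∃ a b, FutureCausal ![a, b, 0, 0] ∧ 0 ≤ b ∧
      adOrbit (alg 0 w) = adOrbit (alg 0 ![a, b, 0, 0]) := by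
  obtain ⟨a, b, d, e, rfl⟩ := exists_vec_eq w
  obtain ⟨c, s, h, hz, -⟩ := exists_rotation d e
  obtain ⟨c', s', h', hz', hr⟩ := exists_rotation b (c * d - s * e)
  have hL := SO13_mul (rot12_mem h') (rot23_mem h)
  have hv : (rot12 c' s' * rot23 c s) *ᵥ ![a, b, d, e] =
      ![a, c' * b - s' * (c * d - s * e), 0, 0] := by
    rw [← mulVec_mulVec]
    ext i
    fin_cases i <;> simp [rot12, rot23, mulVec, dotProduct, Fin.sum_univ_four]
    · ring
    · linear_combination hz'
    · linear_combination hz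
  refine ⟨_, _, by rw [← hv]; exact hw.mulVec hL, hr, ?_⟩
  rw [adOrbit_alg_eq hL (F' := 0) (by simp) _ 0, hv]
  simp

/-- The null rotation commutes with $B$ and changes the third component by $-t(a-b)$. The image of
$B$ is spanned by $e_0+e_1$ and $e_2$, so a translation removes everything else except $a-b$. -/
lemma adOrbit_formB_eq {a b : ℝ} (hab : b < a) (d e : ℝ) :
    adOrbit (alg formB ![a, b, d, e]) = adOrbit (alg formB ![a - b, 0, 0, 0]) := by
  have hp : 0 < a - b := by linarith
  set t := e / (a - b) with ht
  have hte : t * (a - b) = e := div_mul_cancel₀ _ hp.ne'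
  rw [adOrbit_alg_eq (nullRot_mem t) (F' := formB) _ _
    ![d, 0, t ^ 2 / 2 * (a - b) + b - t * e, 0], formB_mulVec]
  · congr 2
    ext i
    fin_cases i <;> simp [nullRot]
    · ring
    · ring
    · linear_combination -hte
  · ext i j
    fin_cases i <;> fin_cases j <;> simp [nullRot, formB, Matrix.mul_apply, Fin.sum_univ_four]
    all_goals ring

lemma adOrbit_formB_eq_zero (a d : ℝ) :
    adOrbit (alg formB ![a, a, d, 0]) = adOrbit (alg formB ![0, 0, 0, 0]) := by
  rw [adOrbit_alg_translate _ _ ![d, 0, a, 0], formB_mulVec]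
  simp

/-! ### Orbits meeting the wedges -/

/-- The families of orbits meeting the timelike wedge. -/
def timelikeFamilies : Set (Set Mat5) :=
  family1 ∪ family2 ∪ family4 1 ∪ family7 1 ∪ family9 1

/-- The families of orbits meeting the causal wedge but not the timelike one. -/
def causalFamilies : Set (Set Mat5) :=
  family5 1 ∪ family6 ∪ family11 1 ∪ family8 0 ∪ family12

lemma alg_zero_zero : alg 0 ![0, 0, 0, 0] = 0 := by
  have : (![0, 0, 0, 0] : Vec) = 0 := by ext i; fin_cases i <;> rfl
  rw [this]
  have : (replicateCol Unit (0 : Vec) : Matrix (Fin 4) Unit ℝ) = 0 := by ext; simp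
  simp [alg, this]

lemma mem_families_of_rotation {θ : ℝ} (hθ : 0 < θ) {w : Vec}
    (h : alg (formA 0 θ) w ∈ wedge semiJ) :
    adOrbit (alg (formA 0 θ) w) ∈ timelikeFamilies ∪ causalFamilies := by
  obtain ⟨a, b, d, e, rfl⟩ := exists_vec_eq w
  -- After a full period only the displacement in the fixed plane survives.
  have hpos : 0 < 2 * Real.pi / θ := by positivity
  have h1 := (alg_formA_rotation_mem_wedge_iff (P := FutureCausal) hθ.ne' a b d e).mp h _ hpos
  rw [mul_div_cancel₀ _ hθ.ne', Real.sin_two_pi, Real.cos_two_pi, futureCausal_vec] at h1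
  have ha : 0 ≤ a := nonneg_of_mul_nonneg_left h1.2 hpos
  have hab : b ^ 2 ≤ a ^ 2 := by
    have h2 : b ^ 2 * (2 * Real.pi / θ) ^ 2 ≤ a ^ 2 * (2 * Real.pi / θ) ^ 2 := by
      have := h1.1
      simp only [mul_zero, sub_self, add_zero, zero_div, mul_pow] at this
      linarith
    exact le_of_mul_le_mul_right h2 (by positivity)
  rw [adOrbit_formA_rotation_drop hθ.ne']
  rcases adOrbit_formA_rotation_causal θ hab ha with
    ⟨r, hr, h⟩ | ⟨-, -, h⟩ | ⟨-, -, h⟩ | ⟨rfl, rfl⟩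
  · exact Or.inl (Or.inl (Or.inl (Or.inr ⟨θ, r, hθ, hr, by rw [h, one_mul]⟩)))
  · exact Or.inr (Or.inl (Or.inl (Or.inl (Or.inl ⟨θ, 1, hθ, Or.inl rfl, h⟩))))
  · exact Or.inr (Or.inl (Or.inl (Or.inl (Or.inl ⟨θ, -1, hθ, Or.inr rfl, h⟩))))
  · exact Or.inr (Or.inl (Or.inl (Or.inl (Or.inr ⟨θ, hθ, rfl⟩))))

lemma mem_families_of_translation {w : Vec} (h : alg 0 w ∈ wedge semiJ) :
    adOrbit (alg 0 w) ∈ timelikeFamilies ∪ causalFamilies := by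
  have h1 := (alg_mem_wedge_iff_of_mulVec_eq_zero (P := FutureCausal) so13.zero_mem
    (zero_mulVec w)).mp h 1 one_pos
  rw [one_smul] at h1
  obtain ⟨a, b, hc, hb, he⟩ := adOrbit_translation_planar h1
  rw [he]
  obtain ⟨hab, ha⟩ := futureCausal_vec.mp hc
  -- With $\theta=0$ the rotation vanishes, so the same reduction handles pure translations; $b\ge0$
  -- will rule out the direction $e_0-e_1$.
  have h2 := adOrbit_formA_rotation_causal 0 (a := a) (b := b) (by linarith) ha
  rw [formA_zero_zero] at h2
  rcases h2 with ⟨r, hr, h⟩ | ⟨-, -, h⟩ | ⟨h0, h0', -⟩ | ⟨rfl, rfl⟩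
  · refine Or.inl (Or.inr ⟨-r ^ 2, by simpa using pow_pos hr 2, ?_⟩)
    rw [h, neg_neg, Real.sqrt_sq hr.le, one_mul]
  · exact Or.inr (Or.inl (Or.inl (Or.inr h)))
  · linarith
  · exact Or.inr (Or.inr (by rw [alg_zero_zero]; rfl))

lemma mem_families_of_formB {w : Vec} (h : alg formB w ∈ wedge semiJ) :
    adOrbit (alg formB w) ∈ timelikeFamilies ∪ causalFamilies := by
  obtain ⟨a, b, d, e, rfl⟩ := exists_vec_eq w
  have h1 := (alg_formB_mem_wedge_iff (P := FutureCausal) a b d e).mp h 1 one_pos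
  rw [futureCausal_vec] at h1
  simp only [mul_one, one_pow] at h1
  obtain ⟨h1, h2⟩ := h1
  -- A future causal displacement has time component at least its first component; their difference
  -- at $s=1$ is $a-b$.
  have hle : b ≤ a := by
    by_contra! hlt
    nlinarith [sq_nonneg (d - (a - b) / 2), sq_nonneg e]
  rcases hle.eq_or_lt with rfl | hlt
  · have he : e = 0 := by nlinarith [sq_nonneg (d - (b - b) / 2), sq_nonneg e]
    subst he
    refine Or.inr (Or.inl (Or.inr ⟨le_rfl, ?_⟩))
    rw [adOrbit_formB_eq_zero, Real.sqrt_zero]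
  · refine Or.inl (Or.inl (Or.inr ⟨(a - b) ^ 2, by have := sub_pos.mpr hlt; positivity, ?_⟩))
    rw [adOrbit_formB_eq hlt, Real.sqrt_sq (sub_pos.mpr hlt).le, one_mul]

lemma mem_families_of_meets_causal {O : Set Mat5} (hO : O ∈ adOrbits)
    (h : (O ∩ wedge semiJ).Nonempty) : O ∈ timelikeFamilies ∪ causalFamilies := by
  obtain ⟨X, -, rfl⟩ := hO
  obtain ⟨Y, hY, hw⟩ := h
  rw [adOrbit_eq_of_mem hY]
  obtain ⟨F, hF, w, rfl⟩ := hw.1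
  have key : ∀ F', LorentzConj F F' → ∃ w', alg F' w' ∈ wedge semiJ ∧
      adOrbit (alg F w) = adOrbit (alg F' w') := by
    rintro F' ⟨L, hL, hLF⟩
    refine ⟨L *ᵥ w, wedge_conj (P := FutureCausal) (fun L hL b hb => hb.mulVec hL) hL hLF hw, ?_⟩
    rw [adOrbit_alg_eq hL hLF w 0, mulVec_zero, add_zero]
  rcases exists_canonical_normalized hF with ⟨φ, θ, hφ, hc⟩ | ⟨θ, hθ, hc⟩ | hc
  -- For $\varphi>0$ the wedge condition carries no information: all such orbits belong to family 1
  -- or 2.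
  · obtain ⟨w', -, he⟩ := key _ hc
    rw [he]
    by_cases hθ : θ = 0
    · subst hθ
      obtain ⟨r, hr, hr'⟩ := adOrbit_formA_boost_eq hφ.ne' w'
      exact Or.inl (Or.inl (Or.inl (Or.inl (Or.inr ⟨φ, r, hφ, hr, hr'⟩))))
    · exact Or.inl (Or.inl (Or.inl (Or.inl (Or.inl
        ⟨φ, θ, hφ, hθ, adOrbit_formA_eq_of_ne hφ.ne' hθ w'⟩))))
  · obtain ⟨w', hw', he⟩ := key _ hc
    rw [he]
    rcases hθ.eq_or_lt with rfl | hθ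
    · rw [formA_zero_zero] at hw' ⊢
      exact mem_families_of_translation hw'
    · exact mem_families_of_rotation hθ hw'
  · obtain ⟨w', hw', he⟩ := key _ hc
    rw [he]
    exact mem_families_of_formB hw'

lemma mem_timelikeFamilies {O : Set Mat5} (h : O ∈ timelikeFamilies) :
    O ∈ adOrbits ∧ (O ∩ wedge semiI).Nonempty := by
  have key : ∀ F ∈ so13, ∀ w : Vec, alg F w ∈ wedge semiI →
      adOrbit (alg F w) ∈ adOrbits ∧ (adOrbit (alg F w) ∩ wedge semiI).Nonempty :=
    fun F hF w hw => ⟨⟨_, ⟨F, hF, w, rfl⟩, rfl⟩, _, mem_adOrbit_self _, hw⟩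
  rcases h with (((⟨φ, θ, hφ, hθ, rfl⟩ | ⟨φ, b, hφ, hb, rfl⟩) | ⟨θ, b, hθ, hb, rfl⟩) |
    ⟨I₃, hI, rfl⟩) | ⟨I₄, hI, rfl⟩
  · rw [← adOrbit_formA_eq_of_ne hφ.ne' hθ ![1, 0, 0, 0]]
    exact key _ (formA_mem_so13 φ θ) _ (boosted_timelike hφ θ le_rfl one_pos (mul_zero θ))
  · have : adOrbit (alg (formA φ 0) ![0, 0, 0, b]) =
        adOrbit (alg (formA φ 0) ![b + 1, 0, 0, b]) := by
      rw [adOrbit_alg_translate _ _ ![0, -((b + 1) / φ), 0, 0], formA_mulVec]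
      congr 2
      ext i
      fin_cases i <;> simp
      field_simp
    rw [this]
    exact key _ (formA_mem_so13 φ 0) _ (boosted_timelike hφ 0 hb (lt_add_one b) (zero_mul b))
  · refine key _ (formA_mem_so13 0 θ) _ ((alg_mem_wedge_iff_of_mulVec_eq_zero
      (formA_mem_so13 0 θ) ?_).mpr fun s hs => FutureTimelike.smul ?_ hs)
    · rw [formA_mulVec]; ext i; fin_cases i <;> simp
    · rw [futureTimelike_vec]
      exact ⟨by nlinarith [mul_pos hb hb], by linarith⟩
  · have hr := Real.sqrt_pos.mpr hI
    rw [one_mul]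
    set r := √I₃
    refine key _ formB_mem_so13 _ ((alg_formB_mem_wedge_iff (P := FutureTimelike) _ _ _ _).mpr
      fun s hs => ?_)
    rw [futureTimelike_vec]
    constructor
    -- This is minus the $\eta$-square of the displacement.
    · have : 0 < (r * s) ^ 2 + r ^ 2 * s ^ 4 / 12 := by positivity
      nlinarith
    · have : 0 < r * s + r * s ^ 3 / 6 := by positivity
      linarith
  · have hr := Real.sqrt_pos.mpr (neg_pos.mpr hI)
    refine key _ so13.zero_mem _ ((alg_mem_wedge_iff_of_mulVec_eq_zero so13.zero_mem
      (zero_mulVec _)).mpr fun s hs => FutureTimelike.smul ?_ hs)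
    rw [futureTimelike_vec, one_mul]
    exact ⟨by nlinarith [mul_pos hr hr], hr⟩

/-- Translates $w+Fc$ do not alter the components in the fixed plane. The 23-components contribute
only nonnegative squares, so any positive time would serve. -/
lemma rotation_meets_timelike {θ : ℝ} (hθ : 0 < θ) {a b : ℝ}
    (h : (adOrbit (alg (formA 0 θ) ![a, b, 0, 0]) ∩ wedge semiI).Nonempty) : b ^ 2 < a ^ 2 := by
  obtain ⟨c, hc⟩ := (adOrbit_alg_meets_iff (P := FutureTimelike)
    (fun L hL b hb => hb.mulVec hL) _ _).mp h
  obtain ⟨c₀, c₁, c₂, c₃, rfl⟩ := exists_vec_eq c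
  rw [formA_mulVec] at hc
  simp only [cons_add_cons, empty_add_empty, neg_zero, zero_mul, add_zero] at hc
  have hpos : 0 < 2 * Real.pi / θ := by positivity
  have h1 := (alg_formA_rotation_mem_wedge_iff (P := FutureTimelike) hθ.ne' _ _ _ _).mp hc _ hpos
  rw [futureTimelike_vec] at h1
  have h2 : b ^ 2 * (2 * Real.pi / θ) ^ 2 < a ^ 2 * (2 * Real.pi / θ) ^ 2 := by
    refine lt_of_le_of_lt ?_ (h1.1.trans_eq (mul_pow _ _ _))
    rw [← mul_pow, add_assoc]
    exact le_add_of_nonneg_right (by positivity)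
  exact lt_of_mul_lt_mul_right h2 (by positivity)

lemma translation_meets_timelike {w : Vec}
    (h : (adOrbit (alg 0 w) ∩ wedge semiI).Nonempty) : FutureTimelike w := by
  obtain ⟨c, hc⟩ := (adOrbit_alg_meets_iff (P := FutureTimelike)
    (fun L hL b hb => hb.mulVec hL) _ _).mp h
  rw [zero_mulVec, add_zero] at hc
  simpa using (alg_mem_wedge_iff_of_mulVec_eq_zero (P := FutureTimelike) so13.zero_mem
    (zero_mulVec w)).mp hc 1 one_pos

/-- The representatives have $Fw=0$ and $w$ causal, so their displacement is $sw$. Missing $L(I)$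
has to be checked for all translates $w+Fc$. -/
lemma mem_causalFamilies {O : Set Mat5} (h : O ∈ causalFamilies) :
    O ∈ adOrbits ∧ (O ∩ wedge semiJ).Nonempty ∧ ¬ (O ∩ wedge semiI).Nonempty := by
  have key : ∀ F ∈ so13, ∀ w : Vec, F *ᵥ w = 0 → FutureCausal w →
      adOrbit (alg F w) ∈ adOrbits ∧ (adOrbit (alg F w) ∩ wedge semiJ).Nonempty :=
    fun F hF w hw hc => ⟨⟨_, ⟨F, hF, w, rfl⟩, rfl⟩, _, mem_adOrbit_self _,
      (alg_mem_wedge_iff_of_mulVec_eq_zero hF hw).mpr fun s hs => hc.smul hs⟩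
  rw [← and_assoc]
  rcases h with (((⟨θ, ε, hθ, hε, rfl⟩ | ⟨θ, hθ, rfl⟩) | rfl) | ⟨-, rfl⟩) | rfl
  · have hε2 : ε ^ 2 = 1 := by rcases hε with rfl | rfl <;> norm_num
    refine ⟨key _ (formA_mem_so13 0 θ) _ ?_ ?_, fun h => ?_⟩
    · rw [formA_mulVec]; ext i; fin_cases i <;> simp
    · rw [futureCausal_vec, hε2]; norm_num
    · have := rotation_meets_timelike hθ h
      linarith
  · refine ⟨key _ (formA_mem_so13 0 θ) _ ?_ ?_, fun h => ?_⟩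
    · rw [formA_mulVec]; ext i; fin_cases i <;> simp
    · rw [futureCausal_vec]; norm_num
    · have := rotation_meets_timelike hθ h
      linarith
  · refine ⟨key _ so13.zero_mem _ (zero_mulVec _) ?_, fun h => ?_⟩
    · rw [futureCausal_vec]; norm_num
    · have := futureTimelike_vec.mp (translation_meets_timelike h)
      norm_num at this
  · rw [Real.sqrt_zero]
    refine ⟨key _ formB_mem_so13 _ ?_ ?_, fun h => ?_⟩
    · rw [formB_mulVec]; ext i; fin_cases i <;> simp
    · rw [futureCausal_vec]; norm_num
    · obtain ⟨c, hc⟩ := (adOrbit_alg_meets_iff (P := FutureTimelike)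
        (fun L hL b hb => hb.mulVec hL) _ _).mp h
      obtain ⟨c₀, c₁, c₂, c₃, rfl⟩ := exists_vec_eq c
      rw [formB_mulVec] at hc
      simp only [cons_add_cons, empty_add_empty, zero_add] at hc
      -- The translate has equal components 0 and 1, and so has its displacement, which therefore
      -- cannot be timelike.
      have h1 := (alg_formB_mem_wedge_iff (P := FutureTimelike) _ _ _ _).mp hc 1 one_pos
      rw [futureTimelike_vec] at h1
      nlinarith [h1.1, sq_nonneg ((c₁ - c₀) * 1 - (-c₂ - -c₂) * 1 ^ 2 / 2)]
  · rw [← alg_zero_zero]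
    refine ⟨key _ so13.zero_mem _ (zero_mulVec _) ?_, fun h => ?_⟩
    · rw [futureCausal_vec]; norm_num
    · exact lt_irrefl _ (futureTimelike_vec.mp (translation_meets_timelike h)).2

end Poincare

end

theorem theorem4p7 :
    {O : Set Poincare.Mat5 | O ∈ Poincare.adOrbits ∧
        (O ∩ Poincare.wedge Poincare.semiI).Nonempty}
      = Poincare.family1 ∪ Poincare.family2 ∪ Poincare.family4 1 ∪ Poincare.family7 1
          ∪ Poincare.family9 1 ∧
    {O : Set Poincare.Mat5 | O ∈ Poincare.adOrbits ∧
        (O ∩ (Poincare.wedge Poincare.semiJ \ Poincare.wedge Poincare.semiI)).Nonempty ∧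
        ¬ (O ∩ Poincare.wedge Poincare.semiI).Nonempty}
      = Poincare.family5 1 ∪ Poincare.family6 ∪ Poincare.family11 1 ∪ Poincare.family8 0
          ∪ Poincare.family12 := by
  constructor
  · ext O
    constructor
    · rintro ⟨hO, h⟩
      exact (Poincare.mem_families_of_meets_causal hO
        (h.mono (Set.inter_subset_inter_right O Poincare.wedge_semiI_subset))).resolve_right
          fun hc => (Poincare.mem_causalFamilies hc).2.2 h
    · exact Poincare.mem_timelikeFamilies
  · ext O
    constructor
    · rintro ⟨hO, h, hn⟩
      exact (Poincare.mem_families_of_meets_causal hO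
        (h.mono (Set.inter_subset_inter_right O Set.sdiff_subset))).resolve_left
          fun ht => hn (Poincare.mem_timelikeFamilies ht).2
    · intro hc
      obtain ⟨hO, ⟨X, hX, hJ⟩, hn⟩ := Poincare.mem_causalFamilies hc
      exact ⟨hO, ⟨X, hX, hJ, fun hI => hn ⟨X, hX, hI⟩⟩, hn⟩
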